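/- Let $G$ be a closed subgroup of the orthogonal group $O(\mathbb{R}^N)$, let $v\in\mathbb{R}^N$ be a unit vector, and let $M=G\cdot v\subset\mathbb{R}^N$ be its orbit (a compact homogeneous space, equivariantly embedded into $\mathbb{R}^N$). Let $L_p(M)$, $1\le p\le\infty$, be the space of real- or complex-valued functions with respect to a finite $G$-invariant Borel measure on $M$. Let $\mathbf{g}$ be the Lie algebra of $G$, i.e. the set of skew-symmetric $N\times N$ matrices $X$ with $\exp tX\in G$ for all $t\in\mathbb{R}$, with the scalar product $\langle X,Y\rangle=\frac12\operatorname{tr}(XY^{t})$, and let $X_1,\dots,X_d$ be an orthonormal basis of $\mathbf{g}$. Let $D_j$ be the infinitesimal generator in $L_p(M)$ of the group $(e^{tD_j}f)(x)=f(\exp (tX_j)\, x)$; that is, $f$ is in the domain of $D_j$ and $D_jf=h$ if and only if $(e^{tD_j}f-f)/t\to h$ in the norm of $L_p(M)$ as $t\to0$. For $\omega\ge 0$ let $\mathbf{B}^p_\omega(\mathbb{D})$, $\mathbb{D}=\{D_1,\dots,D_d\}$, be the set of all $f\in L_p(M)$ such that for all $k\ge 0$ and all $1\le j_1,\dots,j_k\le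 d$ the function $D_{j_1}\cdots D_{j_k}f$ is defined and $\|D_{j_1}\cdots D_{j_k}f\|_p\le\omega^k\|f\|_p$. Let $\mathbf{P}_n(M)$, $n\ge 0$, be the space of restrictions to $M$ of polynomials on $\mathbb{R}^N$ of degree at most $n$ (with coefficients in the same scalar field). Then for every $1\le p\le\infty$ and every $n\ge 0$ $$\mathbf{P}_n(M)\subset\mathbf{B}^p_n(\mathbb{D}).$$ That is, every $f\in\mathbf{P}_n(M)$ belongs to $L_p(M)$, all the functions $D_{j_1}\cdots D_{j_k}f$ are defined, and $$\|D_{j_1}\cdots D_{j_k}f\|_p\le n^k\|f\|_p .$$ -/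

import Mathlib

open MeasureTheory

noncomputable section

namespace EquivariantBernstein

variable {N : ℕ}

/-- The equivariantly embedded homogeneous space `M ⊂ ℝ^N`: the orbit of the vector `v` under the
group `G` of orthogonal matrices. `G` acts on it transitively and `M = G / K` with `K` the
stabilizer of `v`. It carries the topology and the Borel `σ`-algebra induced from `ℝ^N`. -/
def orbit (G : Subgroup (Matrix.orthogonalGroup (Fin N) ℝ)) (v : EuclideanSpace ℝ (Fin N)) :
    Set (EuclideanSpace ℝ (Fin N)) :=
  {x | ∃ g ∈ G, x = Matrix.toEuclideanLin g.1 v}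

variable {G : Subgroup (Matrix.orthogonalGroup (Fin N) ℝ)} {v : EuclideanSpace ℝ (Fin N)}

/-- The action `x ↦ g x` of an element `g ∈ G` on the orbit. -/
def act (g : G) (x : orbit G v) : orbit G v :=
  ⟨Matrix.toEuclideanLin g.1.1 x.1, by
    obtain ⟨h, hG, hx⟩ := x.2
    refine ⟨g.1 * h, G.mul_mem g.2 hG, ?_⟩
    rw [hx]
    simp⟩

theorem continuous_act (g : G) : Continuous (act (v := v) g) :=
  ((Matrix.toEuclideanLin (𝕜 := ℝ) g.1.1).continuous_of_finiteDimensional.comp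
    continuous_subtype_val).subtype_mk _

/-- A measure on `M` is `G`-invariant if every `g ∈ G` transports it to itself. -/
class IsInvariant (μ : Measure (orbit G v)) : Prop where
  map_act : ∀ g : G, μ.map (act g) = μ

theorem measurePreserving_act (μ : Measure (orbit G v)) [IsInvariant μ] (g : G) :
    MeasurePreserving (act g) μ μ :=
  ⟨(continuous_act g).measurable, IsInvariant.map_act g⟩

variable (G) in
/-- The Lie algebra of `G`: the skew-symmetric matrices `X` with `exp (tX) ∈ G` for all real `t`. -/
def lieAlg : Set (Matrix (Fin N) (Fin N) ℝ) :=
  {X | X.transpose = -X ∧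
    ∀ t : ℝ, NormedSpace.exp (t • X) ∈ (Subtype.val '' (G : Set (Matrix.orthogonalGroup (Fin N) ℝ)))}

/-- The element `exp (tX)` of the group `G`, for `X` in the Lie algebra of `G`. -/
def expElem (X : lieAlg G) (t : ℝ) : G :=
  ⟨⟨NormedSpace.exp (t • X.1), by
      obtain ⟨g, _, hg⟩ := X.2.2 t
      exact hg ▸ g.2⟩, by
    obtain ⟨g, hG, hg⟩ := X.2.2 t
    have h : g = ⟨NormedSpace.exp (t • X.1), hg ▸ g.2⟩ := Subtype.ext hg
    exact h ▸ hG⟩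

/-- `X_1, …, X_d` is an orthonormal basis of the Lie algebra of `G` with respect to the inner
product `⟨X, Y⟩ = (1/2) tr (X Yᵗ)`. -/
structure IsOrthonormalBasis {d : ℕ} (X : Fin d → lieAlg G) : Prop where
  orthonormal : ∀ i j, (1 / 2 : ℝ) * ((X i).1 * (X j).1.transpose).trace = if i = j then 1 else 0
  spanning : ∀ Y ∈ lieAlg G, Y ∈ Submodule.span ℝ (Set.range fun i => (X i).1)

variable {𝕜 : Type*} [RCLike 𝕜] {μ : Measure (orbit G v)} [IsInvariant μ]
  {p : ENNReal}

/-- Translation of functions on `M` by `g ∈ G`, as an operator on `L_p(M)`: the function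
`x ↦ f (g x)`. -/
def translate (g : G) (f : Lp 𝕜 p μ) : Lp 𝕜 p μ :=
  Lp.compMeasurePreserving (act g) (measurePreserving_act μ g) f

/-- `IsDeriv X f h` says that `f` is in the domain of the infinitesimal generator `D_X` of the
one-parameter group `(e^{t D_X} f)(x) = f (exp (tX) x)` in `L_p(M)`, and that `D_X f = h`; that is,
`(e^{t D_X} f - f) / t` tends to `h` in the norm of `L_p(M)` as `t → 0`. -/
def IsDeriv [Fact (1 ≤ p)] (X : lieAlg G) (f h : Lp 𝕜 p μ) : Prop :=
  HasDerivAt (fun t : ℝ => translate (expElem X t) f) h 0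

/-- `IsIterDeriv X [i₁, …, iₖ] f h` says that `f` is in the domain of `D_{i₁} ⋯ D_{iₖ}` and that
`D_{i₁} ⋯ D_{iₖ} f = h`, where `D_i` is the generator belonging to `X i`. -/
def IsIterDeriv [Fact (1 ≤ p)] {d : ℕ} (X : Fin d → lieAlg G) :
    List (Fin d) → Lp 𝕜 p μ → Lp 𝕜 p μ → Prop
  | [], f, h => h = f
  | i :: l, f, h => ∃ u, IsIterDeriv X l f u ∧ IsDeriv (X i) u h

/-- The value `D_{i₁} ⋯ D_{iₖ} f` is unique. -/
theorem IsIterDeriv.unique [Fact (1 ≤ p)] {d : ℕ} {X : Fin d → lieAlg G} :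
    ∀ {l : List (Fin d)} {f h h' : Lp 𝕜 p μ},
      IsIterDeriv X l f h → IsIterDeriv X l f h' → h = h'
  | [], _, _, _, e, e' => e.trans e'.symm
  | _ :: _, _, _, _, ⟨_, hu, hd⟩, ⟨_, hu', hd'⟩ => by
    obtain rfl := IsIterDeriv.unique hu hu'
    exact HasDerivAt.unique hd hd'

/-- The Bernstein space `B_ω^p(D)`, `D = {D_1, …, D_d}`: those `f ∈ L_p(M)` such that for all `k` and
all indices `i₁, …, iₖ` the function `D_{i₁} ⋯ D_{iₖ} f` exists in `L_p(M)` and has norm at most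
`ω ^ k * ‖f‖`. -/
def bernsteinSpace [Fact (1 ≤ p)] {d : ℕ} (X : Fin d → lieAlg G) (ω : ℝ) : Set (Lp 𝕜 p μ) :=
  {f | ∀ (k : ℕ) (i : Fin k → Fin d),
    ∃ h, IsIterDeriv X (List.ofFn i) f h ∧ ‖h‖ ≤ ω ^ k * ‖f‖}

variable (G v 𝕜) in
/-- `P_n(M)`: the restrictions to `M` of the polynomials on `ℝ^N` of degree at most `n`, with
coefficients in `𝕜`. -/
def polynomialSpace (n : ℕ) : Set (orbit G v → 𝕜) :=
  {f | ∃ P : MvPolynomial (Fin N) 𝕜, P.totalDegree ≤ n ∧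
    ∀ x : orbit G v, f x = MvPolynomial.eval (fun i => ((x.1 i : ℝ) : 𝕜)) P}

end EquivariantBernstein

end

/-!
The orthonormality of the basis says that every `X i` has `(1/2) tr (X Xᵗ) = 1`. The nonzero
eigenvalues of a real skew-symmetric matrix come in pairs `± i θ`, so the `θ` of the pairs satisfy
`∑ θ ^ 2 = 1`, and the spectrum of `X i` lies in `i [-1, 1]` (`dotProduct_mulVec_self_le`). Hence
the coordinates of `exp (tX) x` are, as functions of `t`, combinations of `cos (a t + b)` with
`|a| ≤ 1` (`inner_flow_mem_cosSums`, `exp_apply_mem_cosSums`), and for a polynomial `P` of degree at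
most `n` the function `t ↦ P (exp (tX) x)` is such a combination with `|a| ≤ n`
(`eval_mem_cosSums`).

For functions `F` of this kind with `|a| ≤ σ`, the Riesz interpolation formula (`hasSum_riesz`)
writes `F' (0)` as an absolutely convergent combination of values of `F`, at nodes and with weights
depending only on `σ`; it amounts to the Fourier series of the triangle wave. The absolute values of
the coefficients add up to `σ`. The formula holds at every point of the orbit, hence for the curve
`t ↦ P (exp (tX) ·)` of bounded continuous functions, and hence in `L_p`. All functions on this
curve have the same `L_p` norm by invariance of the measure, so `‖D_X f‖ ≤ n ‖f‖`
(`norm_deriv_le_of_cosSums`, `norm_polyLp_linearDerivation_le`).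

The curve is differentiable already in the supremum norm, which covers every `p`, and its
derivative is again given by a polynomial of degree at most `n` (`hasDerivAt_aeval_exp`,
`totalDegree_linearDerivation_le`), so the inequality can be iterated
(`exists_isIterDeriv_polyLp`).
-/

noncomputable section

namespace EquivariantBernstein

section

/-! ### The triangle wave -/

theorem hasSum_cos_div_sq {x : ℝ} (hx : x ∈ Set.Icc (0 : ℝ) 1) :
    HasSum (fun n : ℕ => 1 / (n : ℝ) ^ 2 * Real.cos (2 * Real.pi * n * x))
      (Real.pi ^ 2 * (x ^ 2 - x + 1 / 6)) := by
  have h := hasSum_one_div_nat_pow_mul_cos one_ne_zero hx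
  convert! h using 1
  rw [mul_one, Polynomial.bernoulli_def]
  simp [Finset.sum_range_succ, Nat.factorial, bernoulli_one]
  ring

theorem hasSum_odd_cos_div_sq {x : ℝ} (h0 : 0 ≤ x) (h1 : x ≤ 1 / 2) :
    HasSum (fun k : ℕ => 1 / (2 * k + 1 : ℝ) ^ 2 * Real.cos (2 * Real.pi * (2 * k + 1) * x))
      (Real.pi ^ 2 * (1 / 8 - x / 2)) := by
  have ha := hasSum_cos_div_sq (x := x) ⟨h0, by linarith⟩
  have hb := (hasSum_cos_div_sq (x := 2 * x) ⟨by linarith, by linarith⟩).mul_left (1 / 4)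
  set f : ℕ → ℝ := fun n => 1 / (n : ℝ) ^ 2 * Real.cos (2 * Real.pi * n * x) with hf
  have hodd : Summable fun k : ℕ => f (2 * k + 1) :=
    ha.summable.comp_injective (i := fun k : ℕ => 2 * k + 1) (fun a b h => by simpa using h)
  have heven : HasSum (fun k : ℕ => f (2 * k))
      (1 / 4 * (Real.pi ^ 2 * ((2 * x) ^ 2 - 2 * x + 1 / 6))) := by
    refine hb.congr_fun fun k => ?_
    simp only [hf]
    push_cast
    rw [show 2 * Real.pi * (2 * (k : ℝ)) * x = 2 * Real.pi * k * (2 * x) by ring]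
    ring
  have hsum := (heven.even_add_odd hodd.hasSum).unique ha
  convert! hodd.hasSum using 1
  · funext k
    simp [hf]
  · linear_combination -hsum

/-- The Fourier series of the triangle wave. -/
theorem hasSum_triangle_wave {s : ℝ} (hs : |s| ≤ Real.pi / 2) :
    HasSum (fun k : ℕ => (-1 : ℝ) ^ k / (2 * k + 1) ^ 2 * Real.sin ((2 * k + 1) * s))
      (Real.pi * s / 4) := by
  have hpi := Real.pi_pos
  obtain ⟨h1, h2⟩ := abs_le.1 hs
  have h := hasSum_odd_cos_div_sq (x := 1 / 4 - s / (2 * Real.pi))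
    (by rw [sub_nonneg, div_le_iff₀ (by positivity)]; linarith)
    (by rw [sub_le_iff_le_add, ← sub_le_iff_le_add', le_div_iff₀ (by positivity)]; linarith)
  convert! h using 1
  · funext k
    have : 2 * Real.pi * (2 * k + 1) * (1 / 4 - s / (2 * Real.pi))
        = (Real.pi / 2 - (2 * k + 1) * s) + k * Real.pi := by
      field_simp
      ring
    rw [this, Real.cos_add_nat_mul_pi, Real.cos_pi_div_two_sub]
    ring
  · field_simp
    ring

theorem hasSum_one_div_odd_sq :
    HasSum (fun k : ℕ => 1 / (2 * k + 1 : ℝ) ^ 2) (Real.pi ^ 2 / 8) := by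
  have h := hasSum_odd_cos_div_sq le_rfl (by norm_num : (0 : ℝ) ≤ 1 / 2)
  simpa [div_eq_mul_inv] using h

/-! ### Finite cosine sums of bounded frequency -/

variable {𝕜 : Type*} [RCLike 𝕜]

variable (𝕜) in
/-- The finite `𝕜`-linear combinations of the functions `t ↦ cos (a t + b)` with frequency
`|a| ≤ σ`. The phases `b` are arbitrary, so this is the space of almost periodic trigonometric
polynomials with spectrum in `[-σ, σ]`, written without complex exponentials so that real scalars
are covered too. -/
def cosSums (σ : ℝ) : Submodule 𝕜 (ℝ → 𝕜) :=
  Submodule.span 𝕜 {F | ∃ a b : ℝ, |a| ≤ σ ∧ F = fun t => ((Real.cos (a * t + b) : ℝ) : 𝕜)}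

theorem cos_mem_cosSums {σ a : ℝ} (b : ℝ) (ha : |a| ≤ σ) :
    (fun t => ((Real.cos (a * t + b) : ℝ) : 𝕜)) ∈ cosSums 𝕜 σ :=
  Submodule.subset_span ⟨a, b, ha, rfl⟩

theorem sin_mem_cosSums {σ a : ℝ} (ha : |a| ≤ σ) :
    (fun t => ((Real.sin (a * t) : ℝ) : 𝕜)) ∈ cosSums 𝕜 σ := by
  have h := cos_mem_cosSums (𝕜 := 𝕜) (-(Real.pi / 2)) ha
  simpa only [← sub_eq_add_neg, Real.cos_sub_pi_div_two] using h

theorem cosSums_mono {σ τ : ℝ} (h : σ ≤ τ) : cosSums 𝕜 σ ≤ cosSums 𝕜 τ :=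
  Submodule.span_mono fun _ ⟨a, b, ha, hF⟩ => ⟨a, b, ha.trans h, hF⟩

theorem one_mem_cosSums : (1 : ℝ → 𝕜) ∈ cosSums 𝕜 0 := by
  have h := cos_mem_cosSums (𝕜 := 𝕜) (σ := 0) (a := 0) 0 (by simp)
  simpa [Pi.one_def] using h

/-- The spectrum of a product lies in the sum of the spectra. -/
theorem mul_mem_cosSums {σ τ : ℝ} {F H : ℝ → 𝕜} (hF : F ∈ cosSums 𝕜 σ) (hH : H ∈ cosSums 𝕜 τ) :
    F * H ∈ cosSums 𝕜 (σ + τ) := by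
  have h : F * H ∈ cosSums 𝕜 σ * cosSums 𝕜 τ := Submodule.mul_mem_mul hF hH
  rw [cosSums, cosSums, Submodule.span_mul_span] at h
  refine Submodule.span_le.2 ?_ h
  rintro _ ⟨_, ⟨a, b, ha, rfl⟩, _, ⟨c, d, hc, rfl⟩, rfl⟩
  have h₁ := cos_mem_cosSums (𝕜 := 𝕜) (σ := σ + τ) (a := a + c) (b + d)
    ((abs_add_le a c).trans (add_le_add ha hc))
  have h₂ := cos_mem_cosSums (𝕜 := 𝕜) (σ := σ + τ) (a := a - c) (b - d)
    ((abs_sub a c).trans (add_le_add ha hc))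
  convert! Submodule.smul_mem _ (((1 / 2 : ℝ) : ℝ) : 𝕜) (Submodule.add_mem _ h₁ h₂) using 1
  funext t
  have e₁ : (a + c) * t + (b + d) = (a * t + b) + (c * t + d) := by ring
  have e₂ : (a - c) * t + (b - d) = (a * t + b) - (c * t + d) := by ring
  simp only [Pi.mul_apply, Pi.smul_apply, Pi.add_apply, smul_eq_mul]
  rw [← RCLike.ofReal_mul, ← RCLike.ofReal_add, ← RCLike.ofReal_mul, e₁, e₂,
    Real.cos_add (a * t + b), Real.cos_sub (a * t + b)]
  congr 1
  ring

/-! ### Riesz interpolation and Bernstein's inequality -/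

/-- The weights of the Riesz interpolation formula for frequencies in `[-σ, σ]`. -/
def rieszWeight (σ : ℝ) (k : ℕ) : ℝ := 4 * σ / Real.pi ^ 2 * ((-1) ^ k / (2 * k + 1) ^ 2)

/-- The positive nodes of the Riesz interpolation formula for frequencies in `[-σ, σ]`. -/
def rieszNode (σ : ℝ) (k : ℕ) : ℝ := (2 * k + 1) * (Real.pi / (2 * σ))

theorem hasSum_abs_rieszWeight {σ : ℝ} (hσ : 0 < σ) :
    HasSum (fun k => |rieszWeight σ k|) (σ / 2) := by
  convert! hasSum_one_div_odd_sq.mul_left (4 * σ / Real.pi ^ 2) using 1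
  · funext k
    have : (0 : ℝ) ≤ (2 * k + 1) ^ 2 := by positivity
    rw [rieszWeight, abs_mul, abs_div ((-1) ^ k), abs_pow, abs_neg, abs_one, one_pow,
      abs_of_nonneg this, abs_of_nonneg (by positivity : 0 ≤ 4 * σ / Real.pi ^ 2)]
  · field_simp
    norm_num

/-- The Riesz interpolation formula: the derivative of a cosine sum with frequencies in `[-σ, σ]`
is an absolutely convergent combination of its translates. For a single cosine it is the triangle
wave series. -/
theorem hasSum_riesz {σ : ℝ} (hσ : 0 < σ) {F : ℝ → 𝕜} (hF : F ∈ cosSums 𝕜 σ) :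
    ∃ F', HasDerivAt F F' 0 ∧
      HasSum (fun k => rieszWeight σ k • (F (rieszNode σ k) - F (-rieszNode σ k))) F' := by
  induction hF using Submodule.span_induction with
  | mem F h =>
    obtain ⟨a, b, ha, rfl⟩ := h
    have hd : HasDerivAt (fun t : ℝ => Real.cos (a * t + b)) (-(a * Real.sin b)) 0 := by
      have := ((((hasDerivAt_id (0 : ℝ)).const_mul a).add_const b).cos)
      convert! this using 1
      simp
      ring
    refine ⟨((-(a * Real.sin b) : ℝ) : 𝕜), ?_, ?_⟩
    · exact (RCLike.ofRealCLM (K := 𝕜)).hasFDerivAt.comp_hasDerivAt 0 hd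
    · have hs : |a * (Real.pi / (2 * σ))| ≤ Real.pi / 2 := by
        have hp : 0 < Real.pi / (2 * σ) := by positivity
        rw [abs_mul, abs_of_pos hp]
        calc |a| * (Real.pi / (2 * σ)) ≤ σ * (Real.pi / (2 * σ)) := by gcongr
          _ = Real.pi / 2 := by field_simp
      have h := (hasSum_triangle_wave hs).mul_left (-2 * Real.sin b * (4 * σ / Real.pi ^ 2))
      have h' := (RCLike.ofRealCLM (K := 𝕜)).hasSum h
      convert! h' using 1
      · funext k
        simp only [RCLike.ofRealCLM_apply]
        rw [← RCLike.ofReal_sub, RCLike.real_smul_ofReal, ← RCLike.ofReal_mul]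
        congr 1
        rw [show a * -rieszNode σ k + b = b - a * rieszNode σ k by ring,
          add_comm (a * rieszNode σ k) b, Real.cos_add, Real.cos_sub, rieszWeight, rieszNode,
          show a * ((2 * k + 1) * (Real.pi / (2 * σ)))
            = (2 * k + 1) * (a * (Real.pi / (2 * σ))) by ring]
        ring
      · simp only [RCLike.ofRealCLM_apply]
        congr 1
        field_simp
  | zero => exact ⟨0, hasDerivAt_const _ _, by simp⟩
  | add F H _ _ hF hH =>
    obtain ⟨F', hF, hF'⟩ := hF
    obtain ⟨H', hH, hH'⟩ := hH
    refine ⟨F' + H', hF.add hH, (hF'.add hH').congr_fun fun k => ?_⟩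
    rw [← smul_add, Pi.add_apply, Pi.add_apply]
    congr 1
    ring
  | smul c F _ hF =>
    obtain ⟨F', hF, hF'⟩ := hF
    refine ⟨c • F', hF.const_smul c, (hF'.const_smul c).congr_fun fun k => ?_⟩
    rw [Pi.smul_apply, Pi.smul_apply, ← smul_sub, smul_comm]

/-- Bernstein's inequality for a curve `F` of bounded functions whose values at each point are
cosine sums with frequencies in `[-σ, σ]`. The norm in which it is stated is that of the target of a
continuous linear map `L`; the supremum norm only serves to sum the interpolation series. -/
theorem norm_deriv_le_of_cosSums {α V : Type*} [TopologicalSpace α] [NormedAddCommGroup V]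
    [NormedSpace ℝ V] {σ : ℝ} (hσ : 0 < σ) {F : ℝ → BoundedContinuousFunction α 𝕜}
    {F' : BoundedContinuousFunction α 𝕜} (hF : ∀ x, (fun t => F t x) ∈ cosSums 𝕜 σ)
    (hd : HasDerivAt F F' 0) {C : ℝ} (hC : ∀ t, ‖F t‖ ≤ C)
    (L : BoundedContinuousFunction α 𝕜 →L[ℝ] V) {K : ℝ} (hK : ∀ t, ‖L (F t)‖ ≤ K) :
    ‖L F'‖ ≤ σ * K := by
  have hw := hasSum_abs_rieszWeight hσ
  have hsum : Summable fun k => rieszWeight σ k • (F (rieszNode σ k) - F (-rieszNode σ k)) := by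
    refine Summable.of_norm_bounded (hw.mul_right (2 * C)).summable fun k => ?_
    rw [norm_smul, Real.norm_eq_abs]
    refine mul_le_mul_of_nonneg_left ?_ (abs_nonneg _)
    linarith [norm_sub_le (F (rieszNode σ k)) (F (-rieszNode σ k)), hC (rieszNode σ k),
      hC (-rieszNode σ k)]
  have hF' : HasSum (fun k => rieszWeight σ k • (F (rieszNode σ k) - F (-rieszNode σ k))) F' := by
    convert! hsum.hasSum using 1
    ext x
    obtain ⟨y, hy, hy'⟩ := hasSum_riesz hσ (hF x)
    have h₁ : HasDerivAt (fun t => F t x) (F' x) 0 :=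
      (BoundedContinuousFunction.evalCLM ℝ x : _ →L[ℝ] 𝕜).hasFDerivAt.comp_hasDerivAt 0 hd
    have h₂ := (BoundedContinuousFunction.evalCLM ℝ x).hasSum hsum.hasSum
    rw [h₁.unique hy]
    exact hy'.unique h₂
  have h := (L.hasSum hF').norm_le_of_bounded (hw.mul_right (2 * K)) fun k => ?_
  · linarith
  · simp only [map_smul, map_sub]
    rw [norm_smul, Real.norm_eq_abs]
    refine mul_le_mul_of_nonneg_left ?_ (abs_nonneg _)
    linarith [norm_sub_le (L (F (rieszNode σ k))) (L (F (-rieszNode σ k))), hK (rieszNode σ k),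
      hK (-rieszNode σ k)]

end

section

/-! ### Spectrum of a skew-symmetric matrix -/

open scoped Matrix

variable {𝕜 : Type*} [RCLike 𝕜] {ι : Type*} [Fintype ι]

/-- A skew-symmetric matrix of norm one for the inner product `(1/2) tr (X Yᵗ)` is a contraction.
This holds because the nonzero eigenvalues of `Xᵗ X` have even multiplicity. With `y = X u`, the
Cauchy-Schwarz inequality for `X` and `y uᵗ - u yᵗ` gives the bound without diagonalization. -/
theorem dotProduct_mulVec_self_le {X : Matrix ι ι ℝ} (hX : X.transpose = -X)
    (hn : (1 / 2 : ℝ) * (X * X.transpose).trace = 1) (u : ι → ℝ) :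
    X *ᵥ u ⬝ᵥ X *ᵥ u ≤ u ⬝ᵥ u := by
  set y := X *ᵥ u with hy
  have hsk : ∀ i j, X j i = -X i j := fun i j => congr_fun (congr_fun hX i) j
  have hXX : ∑ q : ι × ι, X q.1 q.2 ^ 2 = 2 := by
    rw [Fintype.sum_prod_type]
    have : (X * X.transpose).trace = ∑ i, ∑ j, X i j ^ 2 := by
      simp [Matrix.trace, Matrix.mul_apply, pow_two]
    linarith
  have hmix : ∑ q : ι × ι, X q.1 q.2 * (y q.1 * u q.2 - u q.1 * y q.2) = 2 * (y ⬝ᵥ y) := by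
    have h₁ : ∑ i, ∑ j, X i j * (y i * u j) = y ⬝ᵥ y := by
      refine Finset.sum_congr rfl fun i _ => ?_
      have hyi : y i * y i = y i * ∑ j, X i j * u j := rfl
      rw [hyi, Finset.mul_sum]
      exact Finset.sum_congr rfl fun j _ => by ring
    have h₂ : ∑ i, ∑ j, X i j * (u i * y j) = -(y ⬝ᵥ y) := by
      rw [Finset.sum_comm, ← h₁, ← Finset.sum_neg_distrib]
      refine Finset.sum_congr rfl fun i _ => ?_
      rw [← Finset.sum_neg_distrib]
      exact Finset.sum_congr rfl fun j _ => by rw [hsk i j]; ring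
    simp only [Fintype.sum_prod_type, mul_sub, Finset.sum_sub_distrib, h₁, h₂]
    ring
  have hyy : ∑ q : ι × ι, (y q.1 * u q.2 - u q.1 * y q.2) ^ 2 ≤ 2 * ((y ⬝ᵥ y) * (u ⬝ᵥ u)) := by
    have : ∑ q : ι × ι, (y q.1 * u q.2 - u q.1 * y q.2) ^ 2
        = 2 * ((y ⬝ᵥ y) * (u ⬝ᵥ u)) - 2 * (y ⬝ᵥ u) ^ 2 := by
      have e : ∀ i j, (y i * u j - u i * y j) ^ 2
          = (y i * y i) * (u j * u j) + (u i * u i) * (y j * y j)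
            - 2 * ((y i * u i) * (y j * u j)) := fun i j => by ring
      simp only [Fintype.sum_prod_type, e, Finset.sum_sub_distrib, Finset.sum_add_distrib,
        ← Finset.mul_sum, ← Finset.sum_mul, dotProduct]
      ring
    nlinarith [sq_nonneg (y ⬝ᵥ u)]
  have hcs := Finset.sum_mul_sq_le_sq_mul_sq Finset.univ (fun q : ι × ι => X q.1 q.2)
    fun q => y q.1 * u q.2 - u q.1 * y q.2
  rw [hmix, hXX] at hcs
  have hy0 : 0 ≤ y ⬝ᵥ y := Finset.sum_nonneg fun i _ => mul_self_nonneg _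
  have hu0 : 0 ≤ u ⬝ᵥ u := Finset.sum_nonneg fun i _ => mul_self_nonneg _
  have hsq : (y ⬝ᵥ y) * (y ⬝ᵥ y) ≤ (y ⬝ᵥ y) * (u ⬝ᵥ u) := by nlinarith
  rcases hy0.eq_or_lt with h | h
  · rwa [← h]
  · exact le_of_mul_le_mul_left hsq h

section Flow

variable {E : Type*} [NormedAddCommGroup E] [InnerProductSpace ℝ E] [FiniteDimensional ℝ E]

/-- The coordinates of a solution of `u' = A u`, for a skew-symmetric contraction `A`, are cosine
sums with frequencies in `[-1, 1]`. In an eigenbasis `e` of the symmetric operator `A ^ 2`, whose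
eigenvalues are `-‖A e‖ ^ 2`, the solution starting at `e` is `cos (a t) e + sin (a t) / a • A e`
with `a = ‖A e‖`. -/
theorem inner_flow_mem_cosSums {A : E →L[ℝ] E} (hA : ∀ x y, inner ℝ (A x) y = -inner ℝ x (A y))
    (hA1 : ∀ x, ‖A x‖ ≤ ‖x‖) {u : ℝ → E} (hu : ∀ t, HasDerivAt u (A (u t)) t) (y : E) :
    (fun t => ((inner ℝ y (u t) : ℝ) : 𝕜)) ∈ cosSums 𝕜 1 := by
  have hT : ((A : E →ₗ[ℝ] E) ∘ₗ (A : E →ₗ[ℝ] E)).IsSymmetric := fun x z => by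
    simp [hA]
  set e := hT.eigenvectorBasis rfl with he
  set a : Fin (Module.finrank ℝ E) → ℝ := fun k => ‖A (e k)‖ with ha
  have ha1 : ∀ k, |a k| ≤ 1 := fun k => by
    rw [abs_of_nonneg (norm_nonneg _)]
    exact (hA1 _).trans_eq (e.orthonormal.1 k)
  have hAA : ∀ k, A (A (e k)) = -(a k ^ 2) • e k := fun k => by
    have h : A (A (e k)) = hT.eigenvalues rfl k • e k := by
      exact hT.apply_eigenvectorBasis rfl k
    have h' : hT.eigenvalues rfl k = -(a k ^ 2) := by
      have h₁ : inner ℝ (e k) (A (A (e k))) = hT.eigenvalues rfl k := by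
        rw [h, inner_smul_right, real_inner_self_eq_norm_sq, e.orthonormal.1 k]
        simp
      rw [← h₁, ← neg_inj, ← hA, real_inner_self_eq_norm_sq, neg_neg]
    rw [h, h']
  -- For `a k = 0` the junk value `x / 0 = 0` is harmless, since then `A (e k) = 0`.
  set w : ℝ → E := fun t => ∑ k, inner ℝ (e k) (u 0) •
    (Real.cos (a k * t) • e k + (Real.sin (a k * t) / a k) • A (e k)) with hw
  have hwd : ∀ t, HasDerivAt w (A (w t)) t := fun t => by
    have hk : ∀ k, HasDerivAt
        (fun t => Real.cos (a k * t) • e k + (Real.sin (a k * t) / a k) • A (e k))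
        (A (Real.cos (a k * t) • e k + (Real.sin (a k * t) / a k) • A (e k))) t := fun k => by
      have hl : HasDerivAt (fun t : ℝ => a k * t) (a k) t := by
        simpa using (hasDerivAt_id t).const_mul (a k)
      have h := (hl.cos.smul_const (e k)).add ((hl.sin.div_const (a k)).smul_const (A (e k)))
      convert! h using 1
      rw [map_add, map_smul, map_smul, hAA, smul_smul, add_comm]
      rcases eq_or_ne (a k) 0 with h0 | h0
      · have : A (e k) = 0 := norm_eq_zero.1 h0
        simp [h0, this]
      · congr 2 <;> field_simp
    have h := HasDerivAt.fun_sum (u := Finset.univ) fun k _ =>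
      (hk k).fun_const_smul (inner ℝ (e k) (u 0))
    simpa only [hw, map_sum, map_smul] using h
  have hw0 : w 0 = u 0 := by
    simpa [hw] using e.sum_repr' (u 0)
  have huw : u = w := ODE_solution_unique_univ (v := fun _ => A) (s := fun _ => Set.univ) (t₀ := 0)
    (fun _ => A.lipschitz.lipschitzOnWith) (fun t => ⟨hu t, trivial⟩) (fun t => ⟨hwd t, trivial⟩)
    hw0.symm
  have hexp : (fun t => ((inner ℝ y (u t) : ℝ) : 𝕜)) = ∑ k,
      ((((inner ℝ (e k) (u 0) * inner ℝ y (e k) : ℝ) : 𝕜) •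
          fun t => ((Real.cos (a k * t + 0) : ℝ) : 𝕜)) +
        ((inner ℝ (e k) (u 0) * inner ℝ y (A (e k)) / a k : ℝ) : 𝕜) •
          fun t => ((Real.sin (a k * t) : ℝ) : 𝕜)) := by
    funext t
    rw [congr_fun huw t]
    simp only [hw, inner_sum, inner_smul_right, inner_add_right, Finset.sum_apply, Pi.add_apply,
      Pi.smul_apply, smul_eq_mul, RCLike.ofReal_sum, add_zero]
    refine Finset.sum_congr rfl fun k _ => ?_
    push_cast
    ring
  rw [hexp]
  exact Submodule.sum_mem _ fun k _ => Submodule.add_mem _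
    (Submodule.smul_mem _ _ (cos_mem_cosSums 0 (ha1 k)))
    (Submodule.smul_mem _ _ (sin_mem_cosSums (ha1 k)))

end Flow

section Exp

variable [DecidableEq ι]

open scoped Matrix.Norms.Operator in
theorem hasDerivAt_map_exp_smul {V : Type*} [NormedAddCommGroup V] [NormedSpace ℝ V]
    (L : Matrix ι ι ℝ →ₗ[ℝ] V) (X : Matrix ι ι ℝ) (t : ℝ) :
    HasDerivAt (fun t : ℝ => L (NormedSpace.exp (t • X))) (L (X * NormedSpace.exp (t • X))) t :=
  (LinearMap.toContinuousLinearMap L).hasFDerivAt.comp_hasDerivAt t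
    (hasDerivAt_exp_smul_const' X t)

theorem exp_apply_mem_cosSums {X : Matrix ι ι ℝ} (hX : X.transpose = -X)
    (hn : (1 / 2 : ℝ) * (X * X.transpose).trace = 1) (x : EuclideanSpace ℝ ι) (i : ι) :
    (fun t : ℝ => ((Matrix.toEuclideanLin (NormedSpace.exp (t • X)) x i : ℝ) : 𝕜))
      ∈ cosSums 𝕜 1 := by
  set A := LinearMap.toContinuousLinearMap (Matrix.toEuclideanLin X) with hAdef
  have hA : ∀ x y, inner ℝ (A x) y = -inner ℝ x (A y) := fun x y => by
    simp only [hAdef, EuclideanSpace.inner_eq_star_dotProduct, star_trivial,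
      LinearMap.coe_toContinuousLinearMap', Matrix.ofLp_toLpLin, Matrix.toLin'_apply]
    rw [Matrix.dotProduct_mulVec, ← Matrix.mulVec_transpose, hX, Matrix.neg_mulVec,
      neg_dotProduct, dotProduct_comm]
  have hA1 : ∀ x, ‖A x‖ ≤ ‖x‖ := fun x => by
    have h := dotProduct_mulVec_self_le hX hn x.ofLp
    rw [EuclideanSpace.norm_eq, EuclideanSpace.norm_eq]
    refine Real.sqrt_le_sqrt ?_
    simpa [dotProduct, pow_two, hAdef] using h
  have hu : ∀ t, HasDerivAt (fun t : ℝ => Matrix.toEuclideanLin (NormedSpace.exp (t • X)) x)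
      (A (Matrix.toEuclideanLin (NormedSpace.exp (t • X)) x)) t := fun t => by
    have h := hasDerivAt_map_exp_smul
      ((LinearMap.applyₗ x).comp (Matrix.toEuclideanLin (𝕜 := ℝ) (m := ι) (n := ι)).toLinearMap)
      X t
    simpa [hAdef] using h
  have h := inner_flow_mem_cosSums (𝕜 := 𝕜) hA hA1 hu (EuclideanSpace.single i 1)
  simpa only [EuclideanSpace.inner_single_left, map_one, one_mul] using h

end Exp

end

section

/-! ### Polynomials along one-parameter groups -/

section Polynomial

variable {𝕜 : Type*} [RCLike 𝕜] {ι : Type*}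

/-- A polynomial of degree at most `n` in functions with spectrum in `[-1, 1]` has spectrum in
`[-n, n]`. -/
theorem eval_mem_cosSums {y : ℝ → ι → 𝕜} (hy : ∀ i, (fun t => y t i) ∈ cosSums 𝕜 1) {n : ℕ}
    {P : MvPolynomial ι 𝕜} (hP : P.totalDegree ≤ n) :
    (fun t => MvPolynomial.eval (y t) P) ∈ cosSums 𝕜 n := by
  have hpow : ∀ (i : ι) (k : ℕ), (fun t => y t i) ^ k ∈ cosSums 𝕜 (k : ℝ) := fun i k => by
    induction k with
    | zero => simpa using one_mem_cosSums
    | succ k ih => simpa [pow_succ] using mul_mem_cosSums ih (hy i)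
  have hprod : ∀ (m : ι →₀ ℕ) (S : Finset ι),
      (fun t => ∏ i ∈ S, y t i ^ m i) ∈ cosSums 𝕜 (∑ i ∈ S, (m i : ℝ)) := fun m S => by
    classical
    induction S using Finset.induction_on with
    | empty => simpa [Pi.one_def] using one_mem_cosSums (𝕜 := 𝕜)
    | insert i S hi ih =>
      simp only [Finset.prod_insert hi, Finset.sum_insert hi]
      exact mul_mem_cosSums (hpow i (m i)) ih
  have he : (fun t => MvPolynomial.eval (y t) P)
      = ∑ m ∈ P.support, P.coeff m • fun t => ∏ i ∈ m.support, y t i ^ m i := by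
    funext t
    simp [MvPolynomial.eval_eq]
  rw [he]
  refine Submodule.sum_mem _ fun m hm => Submodule.smul_mem _ _ (cosSums_mono ?_ (hprod m m.support))
  have h := (MvPolynomial.le_totalDegree hm).trans hP
  exact_mod_cast h

/-- A derivation of the polynomial ring sending the variables to polynomials of degree at most one
does not raise the degree. -/
theorem totalDegree_mkDerivation_le {R : Type*} [CommSemiring R] {f : ι → MvPolynomial ι R}
    (hf : ∀ i, (f i).totalDegree ≤ 1) (P : MvPolynomial ι R) :
    (MvPolynomial.mkDerivation R f P).totalDegree ≤ P.totalDegree := by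
  rw [P.as_sum, map_sum, ← P.as_sum]
  refine MvPolynomial.totalDegree_finsetSum_le fun m hm => ?_
  rw [MvPolynomial.mkDerivation_monomial]
  refine (MvPolynomial.totalDegree_smul_le _ _).trans ?_
  refine MvPolynomial.totalDegree_finsetSum_le fun i hi => ?_
  have hsub : (m - Finsupp.single i 1) + Finsupp.single i 1 = m :=
    tsub_add_cancel_of_le (Finsupp.single_le_iff.2 (Nat.one_le_iff_ne_zero.2
      (Finsupp.mem_support_iff.1 hi)))
  have hdeg : (m - Finsupp.single i 1).degree + 1 = m.degree := by
    conv_rhs => rw [← hsub]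
    simp
  have hm' : m.degree ≤ P.totalDegree := MvPolynomial.le_totalDegree hm
  have h₁ := MvPolynomial.totalDegree_mul (MvPolynomial.monomial (m - Finsupp.single i 1)
    ((m i : ℕ) : R)) (f i)
  have h₂ := MvPolynomial.totalDegree_monomial_le (m - Finsupp.single i 1) ((m i : ℕ) : R)
  have h₄ := hf i
  change (MvPolynomial.monomial (m - Finsupp.single i 1) ((m i : ℕ) : R) * f i).totalDegree ≤ _
  change _ ≤ (m - Finsupp.single i 1).degree at h₂
  omega

/-- The chain rule for a polynomial in curves of a commutative Banach algebra, in terms of a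
derivation of the polynomial ring that gives the velocities of the curves. -/
theorem hasDerivAt_aeval {B : Type*} [NormedCommRing B] [NormedAlgebra 𝕜 B] [NormedAlgebra ℝ B]
    (D : Derivation 𝕜 (MvPolynomial ι 𝕜) (MvPolynomial ι 𝕜)) {y : ℝ → ι → B} {t : ℝ}
    (hy : ∀ i, HasDerivAt (fun s => y s i) (MvPolynomial.aeval (y t) (D (MvPolynomial.X i))) t)
    (P : MvPolynomial ι 𝕜) :
    HasDerivAt (fun s => MvPolynomial.aeval (y s) P) (MvPolynomial.aeval (y t) (D P)) t := by
  induction P using MvPolynomial.induction_on with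
  | C a => simpa using hasDerivAt_const t (algebraMap 𝕜 B a)
  | add P Q hP hQ => simpa using hP.fun_add hQ
  | mul_X P i hP =>
    have h := hP.mul (hy i)
    simp only [map_mul, MvPolynomial.aeval_X, Derivation.leibniz, smul_eq_mul, map_add]
    convert! h using 1
    ring

variable [Fintype ι]

variable (𝕜) in
/-- The linear vector field `x ↦ X x` as a derivation of the polynomial ring. -/
def linearDerivation (X : Matrix ι ι ℝ) : Derivation 𝕜 (MvPolynomial ι 𝕜) (MvPolynomial ι 𝕜) :=
  MvPolynomial.mkDerivation 𝕜 fun i => ∑ j, MvPolynomial.C ((X i j : ℝ) : 𝕜) * MvPolynomial.X j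

theorem totalDegree_linearDerivation_le (X : Matrix ι ι ℝ) (P : MvPolynomial ι 𝕜) :
    (linearDerivation 𝕜 X P).totalDegree ≤ P.totalDegree := by
  refine totalDegree_mkDerivation_le (fun i => ?_) P
  refine MvPolynomial.totalDegree_finsetSum_le fun j _ => ?_
  refine (MvPolynomial.totalDegree_mul _ _).trans ?_
  simp

end Polynomial

/-! ### Polynomial functions on the orbit -/

variable {N : ℕ} {G : Subgroup (Matrix.orthogonalGroup (Fin N) ℝ)} {v : EuclideanSpace ℝ (Fin N)}
  {𝕜 : Type*} [RCLike 𝕜]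

theorem norm_eq_of_mem_orbit (x : orbit G v) : ‖x.1‖ = ‖v‖ := by
  obtain ⟨g, _, hx⟩ := x.2
  have hg : g.1.transpose * g.1 = 1 := (Matrix.mem_orthogonalGroup_iff' (Fin N) ℝ).1 g.2
  rw [hx, ← sq_eq_sq₀ (norm_nonneg _) (norm_nonneg _), ← real_inner_self_eq_norm_sq,
    ← real_inner_self_eq_norm_sq]
  simp only [EuclideanSpace.inner_eq_star_dotProduct, star_trivial, Matrix.ofLp_toLpLin,
    Matrix.toLin'_apply]
  rw [Matrix.dotProduct_mulVec, ← Matrix.mulVec_transpose, Matrix.mulVec_mulVec, hg,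
    Matrix.one_mulVec]

variable (G v 𝕜) in
/-- The coordinate functions of `ℝ^N` as bounded continuous functions on the orbit. -/
def coordFun (i : Fin N) : BoundedContinuousFunction (orbit G v) 𝕜 :=
  BoundedContinuousFunction.ofNormedAddCommGroup (fun x => ((x.1 i : ℝ) : 𝕜))
    (by fun_prop) ‖v‖ fun x => by
      rw [RCLike.norm_ofReal, ← norm_eq_of_mem_orbit x, ← Real.norm_eq_abs]
      exact PiLp.norm_apply_le _ _

@[simp]
theorem coordFun_apply (i : Fin N) (x : orbit G v) : coordFun G v 𝕜 i x = ((x.1 i : ℝ) : 𝕜) := rfl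

/-- Composition of the coordinate functions with the linear map of matrix `A`. -/
def linearFun (A : Matrix (Fin N) (Fin N) ℝ) (i : Fin N) :
    BoundedContinuousFunction (orbit G v) 𝕜 :=
  ∑ j, A i j • coordFun G v 𝕜 j

theorem aeval_apply (y : Fin N → BoundedContinuousFunction (orbit G v) 𝕜)
    (P : MvPolynomial (Fin N) 𝕜) (x : orbit G v) :
    MvPolynomial.aeval y P x = MvPolynomial.eval (fun i => y i x) P := by
  induction P using MvPolynomial.induction_on with
  | C a => simp [BoundedContinuousFunction.algebraMap_apply]
  | add P Q hP hQ => simp [hP, hQ]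
  | mul_X P i hP => simp [hP]

theorem linearFun_apply (A : Matrix (Fin N) (Fin N) ℝ) (i : Fin N) (x : orbit G v) :
    linearFun A i x = ((Matrix.toEuclideanLin A x.1 i : ℝ) : 𝕜) := by
  simp [linearFun, Matrix.mulVec, dotProduct, RCLike.real_smul_eq_coe_mul,
    BoundedContinuousFunction.coe_sum]

theorem linearFun_one (i : Fin N) : linearFun 1 i = coordFun G v 𝕜 i := by
  ext x
  simp [linearFun_apply]

/-- The curve `t ↦ P (exp (tX) x)`, as a curve of functions of `x`, has velocity `D_X P`. -/
theorem hasDerivAt_aeval_exp (X : Matrix (Fin N) (Fin N) ℝ) (P : MvPolynomial (Fin N) 𝕜) :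
    HasDerivAt (fun t : ℝ => MvPolynomial.aeval
        (linearFun (G := G) (v := v) (𝕜 := 𝕜) (NormedSpace.exp (t • X))) P)
      (MvPolynomial.aeval (coordFun G v 𝕜) (linearDerivation 𝕜 X P)) 0 := by
  have h0 : linearFun (G := G) (v := v) (𝕜 := 𝕜) (NormedSpace.exp ((0 : ℝ) • X))
      = coordFun G v 𝕜 := by
    funext i
    rw [zero_smul, NormedSpace.exp_zero, linearFun_one]
  have h := hasDerivAt_aeval (linearDerivation 𝕜 X) (t := 0)
    (y := fun t : ℝ => linearFun (G := G) (v := v) (𝕜 := 𝕜) (NormedSpace.exp (t • X)))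
    (fun i => ?_) P
  · rwa [h0] at h
  · have hd : ∀ j, HasDerivAt (fun t : ℝ => NormedSpace.exp (t • X) i j) (X i j) 0 := fun j => by
      simpa using hasDerivAt_map_exp_smul (Matrix.entryLinearMap ℝ ℝ i j) X 0
    have h := HasDerivAt.fun_sum (u := Finset.univ) fun j _ =>
      (hd j).smul_const (coordFun G v 𝕜 j)
    rw [h0]
    convert! h using 1
    ext x
    simp [linearDerivation, MvPolynomial.mkDerivation_X, RCLike.real_smul_eq_coe_mul,
      BoundedContinuousFunction.coe_sum, BoundedContinuousFunction.algebraMap_apply]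

end

section

variable {N : ℕ} {G : Subgroup (Matrix.orthogonalGroup (Fin N) ℝ)} {v : EuclideanSpace ℝ (Fin N)}
  {𝕜 : Type*} [RCLike 𝕜]

/-! ### Bernstein's inequality in `L_p` of the orbit -/

theorem aeval_linearFun_apply (g : G) (P : MvPolynomial (Fin N) 𝕜) (x : orbit G v) :
    MvPolynomial.aeval (linearFun g.1.1) P x
      = MvPolynomial.aeval (coordFun G v 𝕜) P (act g x) := by
  simp only [aeval_apply, linearFun_apply, coordFun_apply, act]

variable (p : ENNReal) [Fact (1 ≤ p)] (μ : Measure (orbit G v)) [IsFiniteMeasure μ]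

variable (v 𝕜) in
/-- The class in `L_p` of the restriction of a polynomial to the orbit. -/
def polyLp (P : MvPolynomial (Fin N) 𝕜) : Lp 𝕜 p μ :=
  BoundedContinuousFunction.toLp p μ ℝ (MvPolynomial.aeval (coordFun G v 𝕜) P)

variable [IsInvariant μ]

theorem translate_polyLp (g : G) (P : MvPolynomial (Fin N) 𝕜) :
    translate g (polyLp v 𝕜 p μ P)
      = BoundedContinuousFunction.toLp p μ ℝ (MvPolynomial.aeval (linearFun g.1.1) P) := by
  have hg := measurePreserving_act μ g
  refine Lp.ext ?_
  refine (Lp.coeFn_compMeasurePreserving _ hg).trans ?_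
  have h := hg.quasiMeasurePreserving.ae_eq_comp (BoundedContinuousFunction.coeFn_toLp p μ ℝ
    (MvPolynomial.aeval (coordFun G v 𝕜) P))
  refine h.trans (Filter.EventuallyEq.trans ?_ (BoundedContinuousFunction.coeFn_toLp p μ ℝ _).symm)
  exact Filter.Eventually.of_forall fun x => (aeval_linearFun_apply g P x).symm

theorem isDeriv_polyLp (X : lieAlg G) (P : MvPolynomial (Fin N) 𝕜) :
    IsDeriv X (polyLp v 𝕜 p μ P) (polyLp v 𝕜 p μ (linearDerivation 𝕜 X.1 P)) := by
  have h := (BoundedContinuousFunction.toLp p μ ℝ (E := 𝕜)).hasFDerivAt.comp_hasDerivAt 0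
    (hasDerivAt_aeval_exp (G := G) (v := v) X.1 P)
  rw [IsDeriv]
  convert! h using 1
  funext t
  exact translate_polyLp p μ (expElem X t) P

/-- Bernstein's inequality for one generator. -/
theorem norm_polyLp_linearDerivation_le (X : lieAlg G)
    (hX : (1 / 2 : ℝ) * (X.1 * X.1.transpose).trace = 1) {n : ℕ} {P : MvPolynomial (Fin N) 𝕜}
    (hP : P.totalDegree ≤ n) :
    ‖polyLp v 𝕜 p μ (linearDerivation 𝕜 X.1 P)‖ ≤ n * ‖polyLp v 𝕜 p μ P‖ := by
  have key : ∀ σ : ℝ, (n : ℝ) < σ →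
      ‖polyLp v 𝕜 p μ (linearDerivation 𝕜 X.1 P)‖ ≤ σ * ‖polyLp v 𝕜 p μ P‖ := fun σ hσ => by
    refine norm_deriv_le_of_cosSums (lt_of_le_of_lt n.cast_nonneg hσ) (fun x => ?_)
      (hasDerivAt_aeval_exp (G := G) (v := v) X.1 P)
      (C := ‖MvPolynomial.aeval (coordFun G v 𝕜) P‖) (fun t => ?_) _ fun t => ?_
    · simp only [aeval_apply, linearFun_apply]
      exact cosSums_mono hσ.le
        (eval_mem_cosSums (fun i => exp_apply_mem_cosSums X.2.1 hX x.1 i) hP)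
    · refine (BoundedContinuousFunction.norm_le (norm_nonneg _)).2 fun x => ?_
      refine (congr_arg norm (aeval_linearFun_apply (expElem X t) P x)).trans_le ?_
      exact BoundedContinuousFunction.norm_coe_le_norm _ _
    · refine (congr_arg norm (translate_polyLp p μ (expElem X t) P)).symm.trans_le ?_
      exact (Lp.norm_compMeasurePreserving _ _).le
  -- The limit `σ → n` takes care of `n = 0`, where the interpolation formula is void.
  have hlim : Filter.Tendsto (fun σ : ℝ => σ * ‖polyLp v 𝕜 p μ P‖) (nhdsWithin (n : ℝ) (Set.Ioi n))
      (nhds (n * ‖polyLp v 𝕜 p μ P‖)) :=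
    (Filter.tendsto_id.mono_left nhdsWithin_le_nhds).mul_const _
  exact ge_of_tendsto hlim (Filter.eventually_of_mem self_mem_nhdsWithin key)

/-- Iterating Bernstein's inequality is possible because the derivatives are again polynomials of
degree at most `n`. -/
theorem exists_isIterDeriv_polyLp {d : ℕ} {X : Fin d → lieAlg G}
    (hX : ∀ i, (1 / 2 : ℝ) * ((X i).1 * (X i).1.transpose).trace = 1) {n : ℕ}
    {P : MvPolynomial (Fin N) 𝕜} (hP : P.totalDegree ≤ n) (l : List (Fin d)) :
    ∃ Q : MvPolynomial (Fin N) 𝕜, Q.totalDegree ≤ n ∧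
      IsIterDeriv X l (polyLp v 𝕜 p μ P) (polyLp v 𝕜 p μ Q) ∧
      ‖polyLp v 𝕜 p μ Q‖ ≤ (n : ℝ) ^ l.length * ‖polyLp v 𝕜 p μ P‖ := by
  induction l with
  | nil => exact ⟨P, hP, rfl, by simp⟩
  | cons i l ih =>
    obtain ⟨Q, hQ, hd, hn⟩ := ih
    refine ⟨linearDerivation 𝕜 (X i).1 Q, (totalDegree_linearDerivation_le _ _).trans hQ,
      ⟨_, hd, isDeriv_polyLp p μ (X i) Q⟩, ?_⟩
    refine (norm_polyLp_linearDerivation_le p μ (X i) (hX i) hQ).trans ?_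
    rw [List.length_cons, pow_succ', mul_assoc]
    gcongr

end

end EquivariantBernstein

end

theorem theorem2p3 {𝕜 : Type*} [RCLike 𝕜] {N : ℕ}
    (G : Subgroup (Matrix.orthogonalGroup (Fin N) ℝ))
    (hG : IsClosed (G : Set (Matrix.orthogonalGroup (Fin N) ℝ)))
    (v : EuclideanSpace ℝ (Fin N)) (hv : ‖v‖ = 1)
    (μ : Measure (EquivariantBernstein.orbit G v)) [IsFiniteMeasure μ]
    [EquivariantBernstein.IsInvariant μ]
    {d : ℕ} (X : Fin d → EquivariantBernstein.lieAlg G)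
    (hX : EquivariantBernstein.IsOrthonormalBasis X)
    (p : ENNReal) [Fact (1 ≤ p)] (n : ℕ)
    (f : EquivariantBernstein.orbit G v → 𝕜)
    (hf : f ∈ EquivariantBernstein.polynomialSpace G v 𝕜 n) :
    ∃ hfp : MemLp f p μ,
      hfp.toLp f ∈ EquivariantBernstein.bernsteinSpace X (n : ℝ) ∧
      ∀ (k : ℕ) (j : Fin k → Fin d), ∃ h : Lp 𝕜 p μ,
        EquivariantBernstein.IsIterDeriv X (List.ofFn j) (hfp.toLp f) h ∧
          ‖h‖ ≤ (n : ℝ) ^ k * ‖hfp.toLp f‖ := by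
  obtain ⟨P, hP, hfP⟩ := hf
  have hcoe : EquivariantBernstein.polyLp v 𝕜 p μ P =ᵐ[μ] f :=
    (BoundedContinuousFunction.coeFn_toLp p μ ℝ _).trans <| Filter.Eventually.of_forall fun x => by
      rw [hfP, EquivariantBernstein.aeval_apply]
      rfl
  have hfp : MemLp f p μ := (Lp.memLp _).ae_eq hcoe
  have heq : hfp.toLp f = EquivariantBernstein.polyLp v 𝕜 p μ P :=
    Lp.ext (hfp.coeFn_toLp.trans hcoe.symm)
  have key : ∀ (k : ℕ) (j : Fin k → Fin d), ∃ h : Lp 𝕜 p μ,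
      EquivariantBernstein.IsIterDeriv X (List.ofFn j) (hfp.toLp f) h ∧
        ‖h‖ ≤ (n : ℝ) ^ k * ‖hfp.toLp f‖ := fun k j => by
    obtain ⟨Q, -, hd, hn⟩ := EquivariantBernstein.exists_isIterDeriv_polyLp p μ
      (fun i => by simpa using hX.orthonormal i i) hP (List.ofFn j)
    rw [List.length_ofFn] at hn
    rw [heq]
    exact ⟨_, hd, hn⟩
  exact ⟨hfp, key, key⟩
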